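/- There is an absolute constant $C$ with the following property. Let $n \ge 2$, $A \in \mathbb{Z}^{m \times n}$ and $b \in \mathbb{R}^m$ be such that $P = \{x \in \mathbb{R}^n : Ax \le b\}$ is a full-dimensional polytope (that is, $P$ is bounded and has non-empty interior). Let $(U, V)$ be a uniformly random pair of orthonormal vectors in $\mathbb{R}^n$, that is, a random pair whose law is the unique probability measure on the set of orthonormal pairs that is invariant under all linear isometries of $\mathbb{R}^n$. The random shadow of $P$ is $\pi(P)$, where $\pi(x) = (U^{\intercal} x, V^{\intercal} x)$; let $s$ be its number of vertices. Then $s$ is a random variable (measurable up to null sets), and: 1. if the determinant of every square submatrix of $A$ is at most $\Delta$ in absolute value, then $\mathbb{E}[s] \le C\, n^3 \Delta^2$; 2. in particular, if $A$ is totally unimodular, then $\mathbb{E}[s] \le C\, n^3$. -/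

import Mathlib

open MeasureTheory ProbabilityTheory
open scoped RealInnerProductSpace ENNReal

noncomputable section

namespace RandomShadow

/-- The polyhedron `{x ∈ ℝⁿ : A x ≤ b}` of an integral matrix `A` and a real right-hand side `b`. -/
def polyhedron {m n : ℕ} (A : Matrix (Fin m) (Fin n) ℤ) (b : Fin m → ℝ) :
    Set (EuclideanSpace ℝ (Fin n)) :=
  {x | ∀ i, ∑ j, (A i j : ℝ) * x j ≤ b i}

/-- Every subdeterminant of `A`, that is, the determinant of every `k × k` submatrix with `k ≥ 1`
(distinct rows and distinct columns, not necessarily contiguous), is at most `Δ` in absolute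
value. -/
def SubdetsBoundedBy {m n : ℕ} (A : Matrix (Fin m) (Fin n) ℤ) (Δ : ℝ) : Prop :=
  ∀ k : ℕ, 1 ≤ k → ∀ (f : Fin k → Fin m) (g : Fin k → Fin n), f.Injective → g.Injective →
    |((A.submatrix f g).det : ℝ)| ≤ Δ

/-- The linear map `π(x) = (uᵀ x, vᵀ x)` from `ℝⁿ` to the plane, for a pair `p = (u, v)`. -/
def proj {n : ℕ} (p : EuclideanSpace ℝ (Fin n) × EuclideanSpace ℝ (Fin n))
    (x : EuclideanSpace ℝ (Fin n)) : ℝ × ℝ :=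
  (⟪p.1, x⟫, ⟪p.2, x⟫)

/-- The shadow of `P` along the pair `p = (u, v)`. -/
def shadow {n : ℕ} (P : Set (EuclideanSpace ℝ (Fin n)))
    (p : EuclideanSpace ℝ (Fin n) × EuclideanSpace ℝ (Fin n)) : Set (ℝ × ℝ) :=
  proj p '' P

/-- The number of vertices (extreme points) of the shadow of `P` along `p`, as an element
of `[0, ∞]`. -/
def numShadowVertices {n : ℕ} (P : Set (EuclideanSpace ℝ (Fin n)))
    (p : EuclideanSpace ℝ (Fin n) × EuclideanSpace ℝ (Fin n)) : ℝ≥0∞ :=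
  (((shadow P p).extremePoints ℝ).encard : ℝ≥0∞)

/-- The Gram-Schmidt orthonormalisation of a pair of vectors (meaningful if they are linearly
independent). -/
def gramSchmidtPair {n : ℕ} (g : EuclideanSpace ℝ (Fin n) × EuclideanSpace ℝ (Fin n)) :
    EuclideanSpace ℝ (Fin n) × EuclideanSpace ℝ (Fin n) :=
  let u := ‖g.1‖⁻¹ • g.1
  let w := g.2 - ⟪u, g.2⟫ • u
  (u, ‖w‖⁻¹ • w)

/-- The uniform distribution on pairs `(U, V)` of orthonormal vectors of `ℝⁿ` (for `n ≥ 2`),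
realised as the orthonormalisation of two independent standard Gaussian vectors. By the three
facts proved below it is, for `n ≥ 2`, a probability measure carried by the orthonormal pairs and
invariant under all linear isometries of `ℝⁿ`; these act transitively on the orthonormal pairs,
so that this is the unique such measure. -/
def uniformFrame (n : ℕ) :
    Measure (EuclideanSpace ℝ (Fin n) × EuclideanSpace ℝ (Fin n)) :=
  ((stdGaussian (EuclideanSpace ℝ (Fin n))).prod
    (stdGaussian (EuclideanSpace ℝ (Fin n)))).map gramSchmidtPair

theorem measurable_gramSchmidtPair (n : ℕ) : Measurable (gramSchmidtPair (n := n)) := by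
  unfold gramSchmidtPair
  fun_prop

instance isProbabilityMeasure_uniformFrame (n : ℕ) : IsProbabilityMeasure (uniformFrame n) :=
  Measure.isProbabilityMeasure_map (measurable_gramSchmidtPair n).aemeasurable

/-- The uniform distribution on orthonormal pairs is invariant under linear isometries. -/
theorem uniformFrame_map_isometry (n : ℕ)
    (T : EuclideanSpace ℝ (Fin n) ≃ₗᵢ[ℝ] EuclideanSpace ℝ (Fin n)) :
    (uniformFrame n).map (Prod.map T T) = uniformFrame n := by
  have hT : Measurable T := T.continuous.measurable
  have hTT : Measurable (Prod.map T T) := hT.prodMap hT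
  have hcomm : (Prod.map T T) ∘ gramSchmidtPair (n := n) = gramSchmidtPair ∘ (Prod.map T T) := by
    funext g
    simp [gramSchmidtPair, ← map_smul, ← map_sub]
  unfold uniformFrame
  rw [Measure.map_map hTT (measurable_gramSchmidtPair n), hcomm,
    ← Measure.map_map (measurable_gramSchmidtPair n) hTT,
    ← Measure.map_prod_map _ _ hT hT, stdGaussian_map]

theorem stdGaussian_submodule {n : ℕ} (S : Submodule ℝ (EuclideanSpace ℝ (Fin n))) (hS : S ≠ ⊤) :
    stdGaussian (EuclideanSpace ℝ (Fin n)) S = 0 := by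
  have hS' : Sᗮ ≠ ⊥ := fun h => hS (Submodule.orthogonal_eq_bot_iff.1 h)
  obtain ⟨w, hw, hw0⟩ := Submodule.exists_mem_ne_zero_of_ne_bot hS'
  have hmap : (stdGaussian (EuclideanSpace ℝ (Fin n))).map (innerSL ℝ w)
      = gaussianReal 0 (‖w‖ ^ 2).toNNReal := by
    rw [IsGaussian.map_eq_gaussianReal, variance_dual_stdGaussian,
      integral_strongDual_stdGaussian, innerSL_apply_norm]
  have hv : (‖w‖ ^ 2).toNNReal ≠ 0 := by
    have : 0 < ‖w‖ ^ 2 := by positivity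
    exact (Real.toNNReal_pos.2 this).ne'
  have := nullSingletonClass_gaussianReal (μ := 0) hv
  have h0 : (stdGaussian (EuclideanSpace ℝ (Fin n))) ((innerSL ℝ w) ⁻¹' {0}) = 0 := by
    rw [← Measure.map_apply (by fun_prop) (measurableSet_singleton 0), hmap]
    exact measure_singleton 0
  refine measure_mono_null (fun x hx => ?_) h0
  have := (Submodule.mem_orthogonal' S w).1 hw x hx
  simpa using this

/-- For `n ≥ 2` the uniform distribution is carried by the orthonormal pairs. -/
theorem uniformFrame_orthonormal {n : ℕ} (hn : 2 ≤ n) :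
    ∀ᵐ p ∂(uniformFrame n), ‖p.1‖ = 1 ∧ ‖p.2‖ = 1 ∧ ⟪p.1, p.2⟫ = 0 := by
  have hmeas : MeasurableSet {p : EuclideanSpace ℝ (Fin n) × EuclideanSpace ℝ (Fin n) |
      ‖p.1‖ = 1 ∧ ‖p.2‖ = 1 ∧ ⟪p.1, p.2⟫ = 0} := by
    refine (measurableSet_eq_fun (by fun_prop) (by fun_prop)).inter
      ((measurableSet_eq_fun (by fun_prop) (by fun_prop)).inter
      (measurableSet_eq_fun (by fun_prop) (by fun_prop)))
  have hspan : ∀ x : EuclideanSpace ℝ (Fin n), Submodule.span ℝ {x} ≠ ⊤ := by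
    intro x h
    have h1 := finrank_span_le_card (R := ℝ) ({x} : Set (EuclideanSpace ℝ (Fin n)))
    rw [h, finrank_top, finrank_euclideanSpace_fin, Set.toFinset_singleton,
      Finset.card_singleton] at h1
    omega
  have hkey : ∀ᵐ g ∂((stdGaussian (EuclideanSpace ℝ (Fin n))).prod
      (stdGaussian (EuclideanSpace ℝ (Fin n)))),
      ‖(gramSchmidtPair g).1‖ = 1 ∧ ‖(gramSchmidtPair g).2‖ = 1 ∧
        ⟪(gramSchmidtPair g).1, (gramSchmidtPair g).2⟫ = 0 := by
    refine (Measure.ae_prod_mem_iff_ae_ae_mem (measurable_gramSchmidtPair n hmeas)).2 ?_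
    have h1 : ∀ᵐ x ∂(stdGaussian (EuclideanSpace ℝ (Fin n))),
        x ∉ Submodule.span ℝ {(0 : EuclideanSpace ℝ (Fin n))} :=
      measure_eq_zero_iff_ae_notMem.1 (stdGaussian_submodule _ (hspan 0))
    filter_upwards [h1] with x hx
    have h2 : ∀ᵐ y ∂(stdGaussian (EuclideanSpace ℝ (Fin n))), y ∉ Submodule.span ℝ {x} :=
      measure_eq_zero_iff_ae_notMem.1 (stdGaussian_submodule _ (hspan x))
    filter_upwards [h2] with y hy
    have hx0 : x ≠ 0 := by
      rintro rfl
      exact hx (Submodule.zero_mem _)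
    have hxn : ‖x‖ ≠ 0 := norm_ne_zero_iff.2 hx0
    have hu : ‖(‖x‖⁻¹ • x)‖ = 1 := by
      rw [norm_smul, norm_inv, norm_norm, inv_mul_cancel₀ hxn]
    have hw : y - ⟪‖x‖⁻¹ • x, y⟫ • (‖x‖⁻¹ • x) ≠ 0 := by
      intro h
      apply hy
      rw [sub_eq_zero.1 h]
      exact Submodule.smul_mem _ _ (Submodule.smul_mem _ _ (Submodule.mem_span_singleton_self x))
    have hwn := norm_ne_zero_iff.2 hw
    refine ⟨hu, ?_, ?_⟩
    · change ‖(‖_‖⁻¹ • _)‖ = 1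
      rw [norm_smul, norm_inv, norm_norm, inv_mul_cancel₀ hwn]
    · change ⟪‖x‖⁻¹ • x, ‖_‖⁻¹ • (y - ⟪‖x‖⁻¹ • x, y⟫ • (‖x‖⁻¹ • x))⟫ = 0
      rw [real_inner_smul_right, inner_sub_right, real_inner_smul_right _ _ ⟪‖x‖⁻¹ • x, y⟫,
        real_inner_self_eq_norm_sq, hu]
      simp
  exact (ae_map_iff (measurable_gramSchmidtPair n).aemeasurable hmeas).2 hkey

/-- The expected number of vertices of a uniformly random shadow of `P`. -/
def expectedShadowVertices {n : ℕ} (P : Set (EuclideanSpace ℝ (Fin n))) : ℝ≥0∞ :=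
  ∫⁻ p, numShadowVertices P p ∂(uniformFrame n)

end RandomShadow

end

namespace RandomShadow

/-! Almost surely the projection is injective on the vertices of `P`. A vertex `v` then projects to
a vertex of the shadow exactly when the plane spanned by the random pair meets the open normal cone
of `v`, so the task is to count the cones met by a random plane. Orthonormalisation does not enlarge
the span, so the pair may be replaced by two independent Gaussian vectors `g₁, g₂`.

Let the direction `cos θ • g₁ + sin θ • g₂` turn. A cone that it meets must be left within the next
half turn, because a cone never contains two opposite vectors. It therefore suffices to bound the
expected number of exits in a short step `ε`. By rotation invariance of the Gaussian pair this is
the probability that `g₁` lies in a cone while `g₁ + tan ε • g₂` does not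
(`prod_stdGaussian_angleVec_leave`).

If the cone contains the ball of radius `τ` around `c`, with `‖c‖ ≤ K`, then a displacement by `y`
can leave the cone only from points that also leave it under translation by `-(‖y‖ / τ) • c`. The
Cameron–Martin formula bounds the mass of these points by a first moment over the cone
(`stdGaussian_sdiff_translate_le`). The cones are disjoint, so the sum over all vertices is one
Gaussian integral, of order `(K / τ) * ε * n`, whatever the number of vertices. Adding up the steps
gives `O((K / τ) * n)`.

Cramer's rule and the bound on subdeterminants give `K = n * √n * Δ` and `τ = 1 / (√n * Δ)`
(`exists_ball_subset_normalCone`), hence `K / τ = n² * Δ²`. -/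

/-! ### Gaussian measure: Cameron–Martin formula and second moment. -/

/-- Up to a constant factor this is the characteristic function of the exponentially tilted
Gaussian, as needed for Cameron–Martin. It factors over the coordinates into one-dimensional complex
moment generating functions. -/
theorem integral_cexp_stdGaussian {n : ℕ} (h t : EuclideanSpace ℝ (Fin n)) :
    ∫ x, Complex.exp ((⟪h, x⟫ : ℂ) + (⟪x, t⟫ : ℂ) * Complex.I)
      ∂stdGaussian (EuclideanSpace ℝ (Fin n))
      = Complex.exp ((‖h‖ : ℂ) ^ 2 / 2 - (‖t‖ : ℂ) ^ 2 / 2 + (⟪h, t⟫ : ℂ) * Complex.I) := by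
  have h1 : ∀ z : ℂ, ∫ x : ℝ, Complex.exp (z * x) ∂gaussianReal 0 1 = Complex.exp (z ^ 2 / 2) := by
    intro z
    have := complexMGF_id_gaussianReal (μ := 0) (v := 1) z
    simpa [complexMGF] using this
  rw [← map_pi_eq_stdGaussian, ← MeasurableEquiv.coe_toLp, integral_map_equiv]
  have h2 : ∀ x : Fin n → ℝ, Complex.exp ((⟪h, MeasurableEquiv.toLp 2 (Fin n → ℝ) x⟫ : ℂ)
      + (⟪MeasurableEquiv.toLp 2 (Fin n → ℝ) x, t⟫ : ℂ) * Complex.I)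
      = ∏ i, Complex.exp (((h i : ℂ) + t i * Complex.I) * x i) := by
    intro x
    rw [← Complex.exp_sum]
    congr 1
    simp only [PiLp.inner_apply, MeasurableEquiv.coe_toLp, RCLike.inner_apply, conj_trivial,
      Complex.ofReal_sum, Complex.ofReal_mul, Finset.sum_mul, ← Finset.sum_add_distrib]
    refine Finset.sum_congr rfl fun i _ => ?_
    ring
  simp_rw [h2]
  rw [integral_fintype_prod_eq_prod (fun i (y : ℝ) =>
    Complex.exp (((h i : ℂ) + t i * Complex.I) * y))]
  simp_rw [h1]
  rw [← Complex.exp_sum]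
  congr 1
  simp only [← Complex.ofReal_pow, EuclideanSpace.real_norm_sq_eq, PiLp.inner_apply,
    RCLike.inner_apply, conj_trivial,
    Complex.ofReal_sum, Complex.ofReal_mul, Finset.sum_mul, Finset.sum_div,
    ← Finset.sum_add_distrib, ← Finset.sum_sub_distrib]
  refine Finset.sum_congr rfl fun i _ => ?_
  have := Complex.I_sq
  push_cast
  linear_combination ((t i : ℂ)) ^ 2 / 2 * this

theorem integrable_exp_inner_stdGaussian {n : ℕ} (h : EuclideanSpace ℝ (Fin n)) :
    Integrable (fun x => Real.exp ⟪h, x⟫) (stdGaussian (EuclideanSpace ℝ (Fin n))) := by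
  have hmap : (stdGaussian (EuclideanSpace ℝ (Fin n))).map (innerSL ℝ h)
      = gaussianReal 0 (‖h‖ ^ 2).toNNReal := by
    rw [IsGaussian.map_eq_gaussianReal, variance_dual_stdGaussian,
      integral_strongDual_stdGaussian, innerSL_apply_norm]
  have := integrable_exp_mul_gaussianReal (μ := 0) (v := (‖h‖ ^ 2).toNNReal) 1
  rw [← hmap, integrable_map_measure (by fun_prop) (by fun_prop)] at this
  simpa [Function.comp_def] using this

/-- The Cameron–Martin formula for the standard Gaussian measure of `ℝⁿ`. -/
theorem stdGaussian_map_const_add {n : ℕ} (h : EuclideanSpace ℝ (Fin n)) :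
    (stdGaussian (EuclideanSpace ℝ (Fin n))).map (fun x => h + x)
      = (stdGaussian (EuclideanSpace ℝ (Fin n))).withDensity
        fun x => ENNReal.ofReal (Real.exp (⟪h, x⟫ - ‖h‖ ^ 2 / 2)) := by
  have hint : Integrable (fun x => Real.exp (⟪h, x⟫ - ‖h‖ ^ 2 / 2))
      (stdGaussian (EuclideanSpace ℝ (Fin n))) := by
    simp_rw [Real.exp_sub]
    exact (integrable_exp_inner_stdGaussian h).div_const _
  have : IsFiniteMeasure ((stdGaussian (EuclideanSpace ℝ (Fin n))).withDensity
      fun x => ENNReal.ofReal (Real.exp (⟪h, x⟫ - ‖h‖ ^ 2 / 2))) :=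
    isFiniteMeasure_withDensity_ofReal hint.2
  have : IsProbabilityMeasure ((stdGaussian (EuclideanSpace ℝ (Fin n))).map (fun x => h + x)) :=
    Measure.isProbabilityMeasure_map (by fun_prop)
  apply Measure.ext_of_charFun
  ext t
  rw [charFun_map_const_add, charFun_stdGaussian, charFun_apply,
    integral_withDensity_eq_integral_toReal_smul (by fun_prop) (by simp)]
  have h2 : ∀ x : EuclideanSpace ℝ (Fin n),
      (ENNReal.ofReal (Real.exp (⟪h, x⟫ - ‖h‖ ^ 2 / 2))).toReal •
        Complex.exp ((⟪x, t⟫ : ℂ) * Complex.I)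
      = Complex.exp (-(‖h‖ : ℂ) ^ 2 / 2) *
        Complex.exp ((⟪h, x⟫ : ℂ) + (⟪x, t⟫ : ℂ) * Complex.I) := by
    intro x
    rw [ENNReal.toReal_ofReal (Real.exp_pos _).le, Complex.real_smul, Complex.ofReal_exp,
      ← Complex.exp_add, ← Complex.exp_add]
    congr 1
    push_cast
    ring
  simp_rw [h2]
  rw [integral_const_mul, integral_cexp_stdGaussian, ← Complex.exp_add, ← Complex.exp_add]
  congr 1
  ring

theorem lintegral_norm_sq_stdGaussian (n : ℕ) :
    ∫⁻ x, ENNReal.ofReal (‖x‖ ^ 2) ∂stdGaussian (EuclideanSpace ℝ (Fin n)) = n := by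
  have hmem : MemLp id 2 (stdGaussian (EuclideanSpace ℝ (Fin n))) := IsGaussian.memLp_two_id
  have hi : ∀ i : Fin n, ∫⁻ x, ENNReal.ofReal ((x i) ^ 2)
      ∂stdGaussian (EuclideanSpace ℝ (Fin n)) = 1 := by
    intro i
    have hm : MemLp (fun x : EuclideanSpace ℝ (Fin n) => x i) 2
        (stdGaussian (EuclideanSpace ℝ (Fin n))) :=
      (hmem.continuousLinearMap_comp (EuclideanSpace.proj (𝕜 := ℝ) i))
    have hv := variance_dual_stdGaussian (innerSL ℝ (EuclideanSpace.single i (1 : ℝ)))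
    have h0 := integral_strongDual_stdGaussian (innerSL ℝ (EuclideanSpace.single i (1 : ℝ)))
    rw [variance_of_integral_eq_zero (by fun_prop) h0, innerSL_apply_norm] at hv
    simp only [innerSL_apply_apply, EuclideanSpace.inner_single_left, map_one, one_mul,
      PiLp.norm_single, norm_one, one_pow] at hv
    rw [← ofReal_integral_eq_lintegral_ofReal hm.integrable_sq
      (Filter.Eventually.of_forall fun x => sq_nonneg _), hv, ENNReal.ofReal_one]
  simp_rw [EuclideanSpace.real_norm_sq_eq]
  simp_rw [ENNReal.ofReal_sum_of_nonneg (fun _ _ => sq_nonneg _)]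
  rw [lintegral_finsetSum _ (by fun_prop)]
  simp [hi]

/-- If translating by `h` maps `D` into itself, then the mass that `D` loses under this
translation is controlled by the first moment of the norm on `D`. -/
theorem stdGaussian_sdiff_translate_le {n : ℕ} {D : Set (EuclideanSpace ℝ (Fin n))}
    (hD : MeasurableSet D) (h : EuclideanSpace ℝ (Fin n)) (hh : ∀ x ∈ D, h + x ∈ D) :
    stdGaussian (EuclideanSpace ℝ (Fin n)) {x | x ∈ D ∧ x - h ∉ D}
      ≤ ∫⁻ x in D, ENNReal.ofReal (‖h‖ * ‖x‖ + ‖h‖ ^ 2 / 2)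
        ∂stdGaussian (EuclideanSpace ℝ (Fin n)) := by
  set γ := stdGaussian (EuclideanSpace ℝ (Fin n))
  have hB : MeasurableSet {x | x - h ∈ D} := (measurable_id.sub_const h) hD
  have h1 : γ {x | x - h ∈ D} = ∫⁻ x in D, ENNReal.ofReal (Real.exp (⟪-h, x⟫ - ‖h‖ ^ 2 / 2)) ∂γ := by
    have h2 := congrArg (fun m => m D) (stdGaussian_map_const_add (-h))
    simp only [withDensity_apply _ hD, norm_neg] at h2
    rw [Measure.map_apply (by fun_prop) hD] at h2
    rw [← h2]
    congr 1
    ext x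
    simp [sub_eq_neg_add]
  -- By `hh`, the translate `D + h` is contained in `D`.
  have h3 : γ {x | x ∈ D ∧ x - h ∉ D} + γ {x | x - h ∈ D} = γ D := by
    rw [← measure_sdiff_add_inter D hB]
    congr 2
    ext x
    simp only [Set.mem_ofPred_eq, Set.mem_inter_iff]
    refine ⟨fun hx => ⟨?_, hx⟩, fun hx => hx.2⟩
    simpa using hh _ hx
  have h4 : γ D ≤ (∫⁻ x in D, ENNReal.ofReal (‖h‖ * ‖x‖ + ‖h‖ ^ 2 / 2) ∂γ)
      + γ {x | x - h ∈ D} := by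
    rw [h1, ← lintegral_add_left (by fun_prop), ← setLIntegral_one]
    refine lintegral_mono fun x => ?_
    simp only
    rw [← ENNReal.ofReal_add (by positivity) (by positivity), ← ENNReal.ofReal_one]
    refine ENNReal.ofReal_le_ofReal ?_
    -- `1 + u ≤ exp u` linearises the Cameron–Martin density.
    have h5 := Real.add_one_le_exp (⟪-h, x⟫ - ‖h‖ ^ 2 / 2)
    have h6 := real_inner_le_norm h x
    rw [inner_neg_left] at h5 ⊢
    linarith
  rw [← h3] at h4
  exact (ENNReal.add_le_add_iff_right (measure_ne_top _ _)).1 h4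

/-! ### Normal cones and the probability of leaving them. -/

/-- The directions in which `v` is the unique maximiser over `W`. -/
def optCone {n : ℕ} (W : Finset (EuclideanSpace ℝ (Fin n))) (v : EuclideanSpace ℝ (Fin n)) :
    Set (EuclideanSpace ℝ (Fin n)) :=
  {z | ∀ w ∈ W, w ≠ v → ⟪z, w⟫ < ⟪z, v⟫}

/-- The closure of the normal cone of every point `v` of `W` contains a ball of radius `τ` around
a point of norm at most `K`. -/
def IsWide {n : ℕ} (W : Finset (EuclideanSpace ℝ (Fin n))) (K τ : ℝ) : Prop :=
  ∀ v ∈ W, ∃ c : EuclideanSpace ℝ (Fin n), ‖c‖ ≤ K ∧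
    ∀ y, ‖y‖ ≤ τ → ∀ w ∈ W, ⟪c + y, w⟫ ≤ ⟪c + y, v⟫

section optCone

variable {n : ℕ} {W : Finset (EuclideanSpace ℝ (Fin n))} {v z r : EuclideanSpace ℝ (Fin n)}

theorem isOpen_optCone (W : Finset (EuclideanSpace ℝ (Fin n))) (v : EuclideanSpace ℝ (Fin n)) :
    IsOpen (optCone W v) := by
  have : optCone W v = ⋂ w ∈ W, {z | w ≠ v → ⟪z, w⟫ < ⟪z, v⟫} := by
    ext z
    simp [optCone]
  rw [this]
  refine isOpen_biInter_finset fun w _ => ?_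
  by_cases h : w = v
  · simp [h]
  · simpa [h] using isOpen_lt (f := fun z => ⟪z, w⟫) (g := fun z => ⟪z, v⟫)
      (by fun_prop) (by fun_prop)

theorem smul_mem_optCone_iff {a : ℝ} (ha : 0 < a) : a • z ∈ optCone W v ↔ z ∈ optCone W v := by
  simp [optCone, real_inner_smul_left, ha]

theorem add_mem_optCone (hz : z ∈ optCone W v) (hr : ∀ w ∈ W, ⟪r, w⟫ ≤ ⟪r, v⟫) :
    z + r ∈ optCone W v := by
  intro w hw hwv
  rw [inner_add_left, inner_add_left]
  exact add_lt_add_of_lt_of_le (hz w hw hwv) (hr w hw)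

theorem neg_notMem_optCone (hW : W.Nontrivial) (hz : z ∈ optCone W v) : -z ∉ optCone W v := by
  intro h
  obtain ⟨w, hw, hwv⟩ := hW.exists_ne v
  have h1 := hz w hw hwv
  have h2 := h w hw hwv
  rw [inner_neg_left, inner_neg_left] at h2
  linarith

theorem pairwiseDisjoint_optCone (W : Finset (EuclideanSpace ℝ (Fin n))) :
    (W : Set (EuclideanSpace ℝ (Fin n))).PairwiseDisjoint (optCone W) := by
  intro v hv w hw hvw
  refine Set.disjoint_left.2 fun z hz hz' => ?_
  exact lt_asymm (hz w hw hvw.symm) (hz' v hv hvw)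

end optCone

variable {n : ℕ} {W : Finset (EuclideanSpace ℝ (Fin n))} {K τ : ℝ}

/-- Leaving a cone by `y` is compared with leaving it by a backward translation along the centre of
its ball. Disjointness of the cones removes any dependence on `W.card`. -/
theorem sum_stdGaussian_leave_optCone_le (hW : IsWide W K τ) (hτ : 0 < τ)
    (y : EuclideanSpace ℝ (Fin n)) :
    ∑ v ∈ W, stdGaussian (EuclideanSpace ℝ (Fin n)) {x | x ∈ optCone W v ∧ x + y ∉ optCone W v}
      ≤ ∫⁻ x, ENNReal.ofReal (K / τ * ‖y‖ * ‖x‖ + (K / τ * ‖y‖) ^ 2 / 2)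
        ∂stdGaussian (EuclideanSpace ℝ (Fin n)) := by
  set γ := stdGaussian (EuclideanSpace ℝ (Fin n))
  have key : ∀ v ∈ W, γ {x | x ∈ optCone W v ∧ x + y ∉ optCone W v}
      ≤ ∫⁻ x in optCone W v, ENNReal.ofReal (K / τ * ‖y‖ * ‖x‖ + (K / τ * ‖y‖) ^ 2 / 2) ∂γ := by
    intro v hv
    obtain ⟨c, hcK, hc⟩ := hW v hv
    have hs : 0 ≤ ‖y‖ / τ := by positivity
    have hnorm : ‖(‖y‖ / τ) • c‖ ≤ K / τ * ‖y‖ := by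
      rw [norm_smul, Real.norm_of_nonneg hs]
      calc ‖y‖ / τ * ‖c‖ ≤ ‖y‖ / τ * K := by gcongr
        _ = K / τ * ‖y‖ := by ring
    calc γ {x | x ∈ optCone W v ∧ x + y ∉ optCone W v}
        ≤ γ {x | x ∈ optCone W v ∧ x - (‖y‖ / τ) • c ∉ optCone W v} := by
          refine measure_mono fun x hx => ⟨hx.1, fun h => hx.2 ?_⟩
          -- The second summand is `‖y‖ / τ` times a point of the ball of radius `τ` around `c`, so
          -- adding it cannot leave the cone.
          have : x + y = (x - (‖y‖ / τ) • c) + ((‖y‖ / τ) • c + y) := by abel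
          rw [this]
          refine add_mem_optCone h fun w hw => ?_
          rcases eq_or_ne y 0 with rfl | hy
          · simp
          · have hy' : 0 < ‖y‖ := norm_pos_iff.2 hy
            have h1 := hc ((τ / ‖y‖) • y) (by
              rw [norm_smul, Real.norm_of_nonneg (by positivity), div_mul_cancel₀ _ hy'.ne']) w hw
            have h2 : (‖y‖ / τ) • c + y = (‖y‖ / τ) • (c + (τ / ‖y‖) • y) := by
              rw [smul_add, smul_smul]
              have : ‖y‖ / τ * (τ / ‖y‖) = 1 := by field_simp
              rw [this, one_smul]
            rw [h2, real_inner_smul_left, real_inner_smul_left]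
            gcongr
      _ ≤ ∫⁻ x in optCone W v, ENNReal.ofReal
            (‖(‖y‖ / τ) • c‖ * ‖x‖ + ‖(‖y‖ / τ) • c‖ ^ 2 / 2) ∂γ := by
          refine stdGaussian_sdiff_translate_le (isOpen_optCone W v).measurableSet _ fun x hx => ?_
          rw [add_comm]
          refine add_mem_optCone hx fun w hw => ?_
          rw [real_inner_smul_left, real_inner_smul_left]
          have := hc 0 (by simpa using hτ.le) w hw
          rw [add_zero] at this
          gcongr
      _ ≤ _ := by
          refine lintegral_mono fun x => ENNReal.ofReal_le_ofReal ?_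
          gcongr
  refine (Finset.sum_le_sum key).trans ?_
  rw [← lintegral_biUnion_finset (pairwiseDisjoint_optCone W)
    (fun v _ => (isOpen_optCone W v).measurableSet)]
  exact setLIntegral_le_lintegral _ _

theorem measurableSet_leave_optCone {α : Type*} [MeasurableSpace α]
    {f g : α → EuclideanSpace ℝ (Fin n)} (hf : Measurable f) (hg : Measurable g)
    (W : Finset (EuclideanSpace ℝ (Fin n))) (v : EuclideanSpace ℝ (Fin n)) :
    MeasurableSet {p | f p ∈ optCone W v ∧ g p ∉ optCone W v} :=
  (hf (isOpen_optCone W v).measurableSet).inter (hg (isOpen_optCone W v).measurableSet).compl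

theorem sum_prod_stdGaussian_leave_optCone_le (hW : IsWide W K τ) (hτ : 0 < τ) (hK : 0 ≤ K)
    {t : ℝ} (ht : 0 ≤ t) (hKt : K / τ * t ≤ 1) :
    ∑ v ∈ W, ((stdGaussian (EuclideanSpace ℝ (Fin n))).prod
      (stdGaussian (EuclideanSpace ℝ (Fin n))))
        {p | p.1 ∈ optCone W v ∧ p.1 + t • p.2 ∉ optCone W v}
      ≤ ENNReal.ofReal (2 * (K / τ * t) * n) := by
  set γ := stdGaussian (EuclideanSpace ℝ (Fin n))
  set s := K / τ * t with hs
  have hs0 : 0 ≤ s := by positivity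
  have hm : ∀ v, MeasurableSet {p : EuclideanSpace ℝ (Fin n) × EuclideanSpace ℝ (Fin n) |
      p.1 ∈ optCone W v ∧ p.1 + t • p.2 ∉ optCone W v} := fun v =>
    measurableSet_leave_optCone (by fun_prop) (by fun_prop) W v
  simp_rw [fun v => Measure.prod_apply_symm (μ := γ) (ν := γ) (hm v)]
  rw [← lintegral_finsetSum' _ fun v _ => (measurable_measure_prodMk_right (hm v)).aemeasurable]
  calc _ ≤ ∫⁻ y, (ENNReal.ofReal (s / 2) * n + ENNReal.ofReal s * ENNReal.ofReal (‖y‖ ^ 2)) ∂γ := by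
        refine lintegral_mono fun y => ?_
        refine (sum_stdGaussian_leave_optCone_le hW hτ (t • y)).trans ?_
        have h1 : ∀ x : EuclideanSpace ℝ (Fin n),
            ENNReal.ofReal (K / τ * ‖t • y‖ * ‖x‖ + (K / τ * ‖t • y‖) ^ 2 / 2)
              ≤ ENNReal.ofReal (s / 2) * ENNReal.ofReal (‖x‖ ^ 2)
                + ENNReal.ofReal s * ENNReal.ofReal (‖y‖ ^ 2) := by
          intro x
          rw [← ENNReal.ofReal_mul (by positivity), ← ENNReal.ofReal_mul (by positivity),
            ← ENNReal.ofReal_add (by positivity) (by positivity)]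
          refine ENNReal.ofReal_le_ofReal ?_
          rw [norm_smul, Real.norm_of_nonneg ht, ← mul_assoc, ← hs]
          have h2 : s * ‖y‖ * ‖x‖ ≤ s * ((‖x‖ ^ 2 + ‖y‖ ^ 2) / 2) := by
            rw [mul_assoc]
            refine mul_le_mul_of_nonneg_left ?_ hs0
            nlinarith [sq_nonneg (‖x‖ - ‖y‖)]
          -- `s ≤ 1` makes the quadratic term linear in `s`.
          have h3 : (s * ‖y‖) ^ 2 ≤ s * ‖y‖ ^ 2 := by
            rw [mul_pow]
            refine mul_le_mul_of_nonneg_right ?_ (sq_nonneg _)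
            nlinarith
          linarith
        refine (lintegral_mono h1).trans ?_
        rw [lintegral_add_right _ measurable_const, lintegral_const_mul _ (by fun_prop),
          lintegral_norm_sq_stdGaussian, lintegral_const, measure_univ, mul_one]
    _ = ENNReal.ofReal (s / 2) * n + ENNReal.ofReal s * n := by
        rw [lintegral_add_left measurable_const, lintegral_const, measure_univ, mul_one,
          lintegral_const_mul _ (by fun_prop), lintegral_norm_sq_stdGaussian]
    _ ≤ _ := by
        rw [← ENNReal.ofReal_natCast, ← ENNReal.ofReal_mul (by positivity),
          ← ENNReal.ofReal_mul (by positivity), ← ENNReal.ofReal_add (by positivity) (by positivity)]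
        refine ENNReal.ofReal_le_ofReal ?_
        have : 0 ≤ s * n := by positivity
        linarith

/-! ### Rotating the direction and counting the cones met by a random plane. -/

/-- The vector at angle `θ` on the ellipse through `p.1` and `p.2`. -/
noncomputable def angleVec (p : EuclideanSpace ℝ (Fin n) × EuclideanSpace ℝ (Fin n)) (θ : ℝ) :
    EuclideanSpace ℝ (Fin n) :=
  Real.cos θ • p.1 + Real.sin θ • p.2

theorem measurable_angleVec (θ : ℝ) : Measurable (fun p => angleVec (n := n) p θ) := by
  unfold angleVec
  fun_prop

/-- The law of an independent Gaussian pair is invariant under rotation by `θ`, which reduces to `θ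
= 0`. Dividing by `cos ε > 0` does not affect membership in a cone. -/
theorem prod_stdGaussian_angleVec_leave (W : Finset (EuclideanSpace ℝ (Fin n)))
    (v : EuclideanSpace ℝ (Fin n)) (θ : ℝ) {ε : ℝ} (hε : 0 < Real.cos ε) :
    ((stdGaussian (EuclideanSpace ℝ (Fin n))).prod (stdGaussian (EuclideanSpace ℝ (Fin n))))
        {p | angleVec p θ ∈ optCone W v ∧ angleVec p (θ + ε) ∉ optCone W v}
      = ((stdGaussian (EuclideanSpace ℝ (Fin n))).prod (stdGaussian (EuclideanSpace ℝ (Fin n))))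
        {p | p.1 ∈ optCone W v ∧ p.1 + Real.tan ε • p.2 ∉ optCone W v} := by
  have hrot := IsGaussian.map_rotation_eq_self (μ := stdGaussian (EuclideanSpace ℝ (Fin n)))
    integral_id_stdGaussian θ
  conv_rhs => rw [← hrot]
  rw [Measure.map_apply (by fun_prop)
    (measurableSet_leave_optCone (by fun_prop) (by fun_prop) W v)]
  congr 1
  ext p
  simp only [Set.mem_ofPred_eq, Set.mem_preimage, ContinuousLinearMap.rotation_apply]
  rw [← smul_mem_optCone_iff (v := v) (z := _ + _ • (_ + _)) hε]
  have : angleVec p (θ + ε) = Real.cos ε • (Real.cos θ • p.1 + Real.sin θ • p.2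
      + Real.tan ε • (-Real.sin θ • p.1 + Real.cos θ • p.2)) := by
    rw [smul_add, smul_smul, mul_comm (Real.cos ε), Real.tan_mul_cos hε.ne', angleVec,
      Real.cos_add, Real.sin_add]
    module
  rw [this, angleVec]

/-- The cone is open, so a fine enough grid of angles has a point in it. Half a turn later the
direction is reversed and outside the cone, so some grid step in between exits. -/
theorem eventually_exists_angleVec_leave (hW : W.Nontrivial) {v : EuclideanSpace ℝ (Fin n)}
    {p : EuclideanSpace ℝ (Fin n) × EuclideanSpace ℝ (Fin n)} {a b : ℝ}
    (hab : a • p.1 + b • p.2 ∈ optCone W v) :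
    ∀ᶠ j : ℕ in Filter.atTop, ∃ k ∈ Finset.range (3 * j),
      angleVec p (-Real.pi + k * (Real.pi / j)) ∈ optCone W v ∧
      angleVec p (-Real.pi + k * (Real.pi / j) + Real.pi / j) ∉ optCone W v := by
  have hpi := Real.pi_pos
  obtain ⟨θ, hθ1, hθ2, hθ⟩ : ∃ θ : ℝ, -Real.pi ≤ θ ∧ θ ≤ Real.pi ∧ angleVec p θ ∈ optCone W v := by
    -- The angle is the argument of `a + b * I`; the modulus is a positive factor that the cone
    -- ignores.
    set z : ℂ := ⟨a, b⟩ with hz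
    have hz0 : z ≠ 0 := by
      intro h
      have h1 : a = 0 := congrArg Complex.re h
      have h2 : b = 0 := congrArg Complex.im h
      rw [h1, h2, zero_smul, zero_smul, add_zero] at hab
      exact neg_notMem_optCone hW hab (by simpa using hab)
    refine ⟨z.arg, (Complex.neg_pi_lt_arg z).le, Complex.arg_le_pi z, ?_⟩
    rw [← smul_mem_optCone_iff (norm_pos_iff.2 hz0), angleVec, smul_add, smul_smul, smul_smul,
      Complex.norm_mul_cos_arg, Complex.norm_mul_sin_arg]
    exact hab
  have hcont : Continuous (angleVec p) := by
    unfold angleVec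
    fun_prop
  obtain ⟨δ, hδ, hball⟩ := Metric.isOpen_iff.1 ((isOpen_optCone W v).preimage hcont) θ hθ
  have hlim : Filter.Tendsto (fun j : ℕ => Real.pi / j) Filter.atTop (nhds 0) :=
    tendsto_const_div_atTop_nhds_zero_nat _
  filter_upwards [hlim.eventually_lt_const hδ, Filter.eventually_ge_atTop 1] with j hj hj1
  have hj0 : (0 : ℝ) < j := by exact_mod_cast hj1
  set ε := Real.pi / j with hε
  have hε0 : 0 < ε := by positivity
  set k₀ := ⌊(θ + Real.pi) / ε⌋₊ with hk₀
  have hk1 : (k₀ : ℝ) * ε ≤ θ + Real.pi :=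
    (le_div_iff₀ hε0).1 (Nat.floor_le (div_nonneg (by linarith) hε0.le))
  have hk2 : θ + Real.pi < (k₀ + 1) * ε := (div_lt_iff₀ hε0).1 (Nat.lt_floor_add_one _)
  have hjε : (j : ℝ) * ε = Real.pi := by
    rw [hε]
    field_simp
  -- Since `θ ≤ π`, the `j` steps that follow `k₀` stay inside `range (3 * j)`, which covers the
  -- angles from `-π` to `2π`.
  have hk3 : k₀ ≤ 2 * j := by
    have : (k₀ : ℝ) * ε ≤ (2 * j : ℕ) * ε := by
      push_cast
      linarith
    exact_mod_cast le_of_mul_le_mul_right this hε0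
  have hin : angleVec p (-Real.pi + (k₀ : ℝ) * ε) ∈ optCone W v := by
    apply hball
    rw [Metric.mem_ball, Real.dist_eq, abs_lt]
    constructor <;> linarith
  have hout : angleVec p (-Real.pi + ((k₀ + j : ℕ) : ℝ) * ε) ∉ optCone W v := by
    have : angleVec p (-Real.pi + ((k₀ + j : ℕ) : ℝ) * ε)
        = -angleVec p (-Real.pi + (k₀ : ℝ) * ε) := by
      have h1 : -Real.pi + ((k₀ + j : ℕ) : ℝ) * ε = -Real.pi + (k₀ : ℝ) * ε + Real.pi := by
        push_cast
        linarith
      rw [h1, angleVec, angleVec, Real.cos_add_pi, Real.sin_add_pi]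
      module
    rw [this]
    exact neg_notMem_optCone hW hin
  by_contra! hcon
  have hind : ∀ i ≤ j, angleVec p (-Real.pi + ((k₀ + i : ℕ) : ℝ) * ε) ∈ optCone W v := by
    intro i
    induction i with
    | zero => exact fun _ => hin
    | succ i ih =>
      intro hi
      have h1 := hcon (k₀ + i) (Finset.mem_range.2 (by omega)) (ih (by omega))
      have h2 : -Real.pi + ((k₀ + (i + 1) : ℕ) : ℝ) * ε
          = -Real.pi + ((k₀ + i : ℕ) : ℝ) * ε + ε := by
        push_cast
        ring
      rwa [h2]
  exact hout (hind j le_rfl)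

/-- The pairs of vectors whose span meets the normal cone of `v`. -/
def hitSet (W : Finset (EuclideanSpace ℝ (Fin n))) (v : EuclideanSpace ℝ (Fin n)) :
    Set (EuclideanSpace ℝ (Fin n) × EuclideanSpace ℝ (Fin n)) :=
  {p | ∃ a b : ℝ, a • p.1 + b • p.2 ∈ optCone W v}

theorem isOpen_hitSet (W : Finset (EuclideanSpace ℝ (Fin n))) (v : EuclideanSpace ℝ (Fin n)) :
    IsOpen (hitSet W v) := by
  have : hitSet W v = ⋃ a : ℝ, ⋃ b : ℝ, (fun p => a • p.1 + b • p.2) ⁻¹' optCone W v := by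
    ext p
    simp [hitSet]
  rw [this]
  exact isOpen_iUnion fun a => isOpen_iUnion fun b =>
    (isOpen_optCone W v).preimage (by fun_prop)

/-- The number of points of `W` whose normal cone meets the span of the pair. -/
noncomputable def hitCount (W : Finset (EuclideanSpace ℝ (Fin n)))
    (p : EuclideanSpace ℝ (Fin n) × EuclideanSpace ℝ (Fin n)) : ℝ≥0∞ :=
  ∑ v ∈ W, (hitSet W v).indicator (fun _ => 1) p

theorem measurable_hitCount (W : Finset (EuclideanSpace ℝ (Fin n))) : Measurable (hitCount W) :=
  Finset.measurable_fun_sum _ fun v _ =>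
    measurable_const.indicator (isOpen_hitSet W v).measurableSet

/-- The number of exits on a grid of step `π / j` eventually dominates the number of cones met, so
Fatou's lemma applies. The constant is `12π = 3j · 2 · 2 · (π / j)`: the number of steps, the exit
bound, and `tan ε ≤ 2ε`. -/
theorem lintegral_hitCount_le (hW : IsWide W K τ) (hτ : 0 < τ) (hK : 0 ≤ K)
    (hnt : W.Nontrivial) :
    ∫⁻ p, hitCount W p ∂((stdGaussian (EuclideanSpace ℝ (Fin n))).prod
      (stdGaussian (EuclideanSpace ℝ (Fin n)))) ≤ ENNReal.ofReal (12 * Real.pi * (K / τ) * n) := by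
  set ν := (stdGaussian (EuclideanSpace ℝ (Fin n))).prod (stdGaussian (EuclideanSpace ℝ (Fin n)))
  set T : EuclideanSpace ℝ (Fin n) → ℕ → ℕ →
      Set (EuclideanSpace ℝ (Fin n) × EuclideanSpace ℝ (Fin n)) := fun v j k =>
    {p | angleVec p (-Real.pi + k * (Real.pi / j)) ∈ optCone W v ∧
      angleVec p (-Real.pi + k * (Real.pi / j) + Real.pi / j) ∉ optCone W v} with hT
  have hTm : ∀ v j k, MeasurableSet (T v j k) := fun v j k =>
    measurableSet_leave_optCone (measurable_angleVec _) (measurable_angleVec _) W v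
  set G : ℕ → EuclideanSpace ℝ (Fin n) × EuclideanSpace ℝ (Fin n) → ℝ≥0∞ := fun j p =>
    ∑ v ∈ W, ∑ k ∈ Finset.range (3 * j), (T v j k).indicator (fun _ => 1) p with hG
  have hGm : ∀ j, Measurable (G j) := fun j =>
    Finset.measurable_fun_sum _ fun v _ => Finset.measurable_fun_sum _ fun k _ =>
      measurable_const.indicator (hTm v j k)
  have hle : ∀ p, hitCount W p ≤ Filter.liminf (fun j => G j p) Filter.atTop := by
    intro p
    refine Filter.le_liminf_of_le (by isBoundedDefault) ?_
    have h1 : ∀ v ∈ W, ∀ᶠ j in Filter.atTop, (hitSet W v).indicator (fun _ => 1) p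
        ≤ ∑ k ∈ Finset.range (3 * j), (T v j k).indicator (fun _ => (1 : ℝ≥0∞)) p := by
      intro v _
      by_cases hp : p ∈ hitSet W v
      · obtain ⟨a, b, hab⟩ := id hp
        filter_upwards [eventually_exists_angleVec_leave hnt hab] with j hj
        obtain ⟨k, hk, hkT⟩ := hj
        rw [Set.indicator_of_mem hp]
        have h2 : (T v j k).indicator (fun _ => (1 : ℝ≥0∞)) p = 1 :=
          Set.indicator_of_mem (show p ∈ T v j k from hkT) _
        refine h2.symm.le.trans ?_
        exact Finset.single_le_sum (f := fun k => (T v j k).indicator (fun _ => (1 : ℝ≥0∞)) p)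
          (fun _ _ => zero_le) hk
      · simp [Set.indicator_of_notMem hp]
    filter_upwards [(Finset.eventually_all W).2 h1] with j hj
    exact Finset.sum_le_sum hj
  refine (lintegral_mono hle).trans ((lintegral_liminf_le hGm).trans ?_)
  have hlim : Filter.Tendsto (fun j : ℕ => Real.pi / j) Filter.atTop (nhds 0) :=
    tendsto_const_div_atTop_nhds_zero_nat _
  have hlim2 : Filter.Tendsto (fun j : ℕ => K / τ * (2 * (Real.pi / j))) Filter.atTop (nhds 0) := by
    simpa using (hlim.const_mul 2).const_mul (K / τ)
  refine Filter.liminf_le_of_frequently_le' (Filter.Eventually.frequently ?_)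
  filter_upwards [hlim.eventually_le_const one_pos, hlim2.eventually_le_const one_pos,
    Filter.eventually_ge_atTop 1] with j hj1 hj2 hj3
  have hj0 : (0 : ℝ) < j := by exact_mod_cast hj3
  have hε0 : 0 < Real.pi / j := by positivity
  have hcos : 1 / 2 ≤ Real.cos (Real.pi / j) := by
    have := Real.one_sub_sq_div_two_le_cos (x := Real.pi / j)
    nlinarith
  have hcos0 : 0 < Real.cos (Real.pi / j) := by linarith
  have hsin0 : 0 ≤ Real.sin (Real.pi / j) :=
    Real.sin_nonneg_of_nonneg_of_le_pi hε0.le (by linarith [Real.pi_gt_three])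
  have htan0 : 0 ≤ Real.tan (Real.pi / j) := by
    rw [Real.tan_eq_sin_div_cos]
    positivity
  have htan : Real.tan (Real.pi / j) ≤ 2 * (Real.pi / j) := by
    rw [Real.tan_eq_sin_div_cos, div_le_iff₀ hcos0]
    have := Real.sin_le hε0.le
    nlinarith
  have hKτ : 0 ≤ K / τ := by positivity
  have hKt : K / τ * Real.tan (Real.pi / j) ≤ K / τ * (2 * (Real.pi / j)) := by gcongr
  calc ∫⁻ p, G j p ∂ν = ∑ k ∈ Finset.range (3 * j), ∑ v ∈ W, ν (T v j k) := by
        simp only [hG]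
        rw [lintegral_finsetSum _ fun v _ => Finset.measurable_fun_sum _ fun k _ =>
          measurable_const.indicator (hTm v j k), Finset.sum_comm]
        refine Finset.sum_congr rfl fun v _ => ?_
        rw [lintegral_finsetSum _ fun k _ => measurable_const.indicator (hTm v j k)]
        exact Finset.sum_congr rfl fun k _ => lintegral_indicator_one (hTm v j k)
    _ ≤ ∑ k ∈ Finset.range (3 * j),
          ENNReal.ofReal (2 * (K / τ * Real.tan (Real.pi / j)) * n) := by
        refine Finset.sum_le_sum fun k _ => ?_
        refine le_trans (le_of_eq (Finset.sum_congr rfl fun v _ =>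
          prod_stdGaussian_angleVec_leave W v _ hcos0)) ?_
        exact sum_prod_stdGaussian_leave_optCone_le hW hτ hK htan0 (hKt.trans hj2)
    _ ≤ _ := by
        rw [Finset.sum_const, Finset.card_range, nsmul_eq_mul, ← ENNReal.ofReal_natCast,
          ← ENNReal.ofReal_mul (by positivity)]
        refine ENNReal.ofReal_le_ofReal ?_
        have : 12 * Real.pi * (K / τ) * n
            = (3 * j : ℕ) * (2 * (K / τ * (2 * (Real.pi / j))) * n) := by
          push_cast
          field_simp
          ring
        rw [this]
        gcongr


/-! ### Vertices of the shadow as cones met by the plane. -/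

theorem isLinearMap_proj (p : EuclideanSpace ℝ (Fin n) × EuclideanSpace ℝ (Fin n)) :
    IsLinearMap ℝ (proj p) where
  map_add x y := by simp [proj, inner_add_right]
  map_smul a x := by simp [proj, real_inner_smul_right]

theorem mem_extremePoints_convexHull_of_forall_lt {E : Type*} [AddCommGroup E] [Module ℝ E]
    {Q : Set E} {q : E} (hq : q ∈ Q) (l : E →ₗ[ℝ] ℝ) (hl : ∀ y ∈ Q, y ≠ q → l y < l q) :
    q ∈ (convexHull ℝ Q).extremePoints ℝ := by
  have hconv : Convex ℝ {y | y = q ∨ l y < l q} := by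
    rw [convex_iff_forall_pos]
    intro x hx y hy a b ha hb hab
    have hxle : l x ≤ l q := hx.elim (fun h => h ▸ le_rfl) le_of_lt
    have hyle : l y ≤ l q := hy.elim (fun h => h ▸ le_rfl) le_of_lt
    have hsum : l (a • x + b • y) = a * l x + b * l y := by simp
    have hq : l q = a * l q + b * l q := by rw [← add_mul, hab, one_mul]
    rcases hx with rfl | hx
    · rcases hy with rfl | hy
      · left
        rw [← add_smul, hab, one_smul]
      · right
        rw [hsum]
        nlinarith
    · right
      rw [hsum]
      nlinarith
  have hsub : convexHull ℝ Q ⊆ {y | y = q ∨ l y < l q} :=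
    convexHull_min (fun y hy => or_iff_not_imp_left.2 (hl y hy)) hconv
  refine mem_extremePoints_iff_left.2 ⟨subset_convexHull ℝ Q hq, ?_⟩
  rintro x hx y hy ⟨a, b, ha, hb, hab, hxy⟩
  have hyle : l y ≤ l q := (hsub hy).elim (fun h => h ▸ le_rfl) le_of_lt
  refine (hsub hx).resolve_right fun hlt => ?_
  have hsum : l q = a * l x + b * l y := by
    rw [← hxy]
    simp
  have hq : l q = a * l q + b * l q := by rw [← add_mul, hab, one_mul]
  nlinarith

/-- A vertex of a polygon is the unique maximiser of some functional `(a, b)`, which pulls back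
along the projection to the inner product with `a • p.1 + b • p.2`. Injectivity on `W` carries
uniqueness between `W` and its image. -/
theorem numShadowVertices_eq_hitCount (W : Finset (EuclideanSpace ℝ (Fin n)))
    (p : EuclideanSpace ℝ (Fin n) × EuclideanSpace ℝ (Fin n)) (hp : Set.InjOn (proj p) W) :
    numShadowVertices (convexHull ℝ (W : Set (EuclideanSpace ℝ (Fin n)))) p = hitCount W p := by
  classical
  set Q := proj p '' (W : Set (EuclideanSpace ℝ (Fin n))) with hQ
  have hsh : shadow (convexHull ℝ (W : Set (EuclideanSpace ℝ (Fin n)))) p = convexHull ℝ Q :=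
    (isLinearMap_proj p).image_convexHull _
  have hext : (convexHull ℝ Q).extremePoints ℝ
      = proj p '' ((W.filter fun v => p ∈ hitSet W v : Finset _) : Set _) := by
    ext q
    constructor
    · intro hq
      obtain ⟨v, hv, rfl⟩ := extremePoints_convexHull_subset hq
      refine ⟨v, Finset.mem_coe.2 (Finset.mem_filter.2 ⟨hv, ?_⟩), rfl⟩
      have hnot := (((convex_convexHull ℝ Q).mem_extremePoints_iff_mem_sdiff_convexHull_sdiff).1
        hq).2
      have hnot' : proj p v ∉ convexHull ℝ (Q \ {proj p v}) := fun h =>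
        hnot (convexHull_mono (Set.sdiff_subset_sdiff_left (subset_convexHull ℝ Q)) h)
      have hfin : (Q \ {proj p v}).Finite := (W.finite_toSet.image _).sdiff
      obtain ⟨f, u, hf1, hf2⟩ := geometric_hahn_banach_closed_point
        (convex_convexHull ℝ (Q \ {proj p v})) (hfin.isClosed_convexHull ℝ) hnot'
      refine ⟨f (1, 0), f (0, 1), fun w hw hwv => ?_⟩
      have hfp : ∀ x, ⟪f (1, 0) • p.1 + f (0, 1) • p.2, x⟫ = f (proj p x) := by
        intro x
        have : proj p x = ⟪p.1, x⟫ • ((1 : ℝ), (0 : ℝ)) + ⟪p.2, x⟫ • ((0 : ℝ), (1 : ℝ)) := by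
          simp [proj]
        rw [this, map_add, map_smul, map_smul, inner_add_left, real_inner_smul_left,
          real_inner_smul_left, smul_eq_mul, smul_eq_mul]
        ring
      rw [hfp, hfp]
      exact (hf1 _ (subset_convexHull ℝ _ ⟨Set.mem_image_of_mem _ hw,
        fun h => hwv (hp hw hv h)⟩)).trans hf2
    · rintro ⟨v, hv, rfl⟩
      obtain ⟨hvW, a, b, hab⟩ := Finset.mem_filter.1 (Finset.mem_coe.1 hv)
      set l : ℝ × ℝ →ₗ[ℝ] ℝ := a • LinearMap.fst ℝ ℝ ℝ + b • LinearMap.snd ℝ ℝ ℝ with hl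
      have hlp : ∀ x, l (proj p x) = ⟪a • p.1 + b • p.2, x⟫ := by
        intro x
        simp [hl, proj, inner_add_left, real_inner_smul_left]
      refine mem_extremePoints_convexHull_of_forall_lt (Set.mem_image_of_mem _ hvW) l ?_
      rintro _ ⟨w, hw, rfl⟩ hne
      rw [hlp, hlp]
      exact hab w hw fun h => hne (h ▸ rfl)
  rw [numShadowVertices, hsh, hext, Set.InjOn.encard_image
    (hp.mono (Finset.coe_subset.2 (Finset.filter_subset _ _))), Set.encard_coe_eq_coe_finsetCard]
  simp [hitCount, Set.indicator_apply]

/-- The new pair lies in the span of the old one, even when the old pair is linearly dependent. -/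
theorem hitCount_gramSchmidtPair_le (W : Finset (EuclideanSpace ℝ (Fin n)))
    (p : EuclideanSpace ℝ (Fin n) × EuclideanSpace ℝ (Fin n)) :
    hitCount W (gramSchmidtPair p) ≤ hitCount W p := by
  refine Finset.sum_le_sum fun v _ => ?_
  by_cases h : gramSchmidtPair p ∈ hitSet W v
  · have h' : p ∈ hitSet W v := by
      obtain ⟨a, b, hab⟩ := h
      simp only [gramSchmidtPair] at hab
      set c := ⟪‖p.1‖⁻¹ • p.1, p.2⟫
      set d := ‖p.2 - c • ‖p.1‖⁻¹ • p.1‖⁻¹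
      refine ⟨a * ‖p.1‖⁻¹ - b * d * c * ‖p.1‖⁻¹, b * d, ?_⟩
      convert hab using 1
      module
    rw [Set.indicator_of_mem h, Set.indicator_of_mem h']
  · simp [Set.indicator_of_notMem h]

theorem ae_stdGaussian_inner_ne_zero {x : EuclideanSpace ℝ (Fin n)} (hx : x ≠ 0) :
    ∀ᵐ g ∂stdGaussian (EuclideanSpace ℝ (Fin n)), ⟪g, x⟫ ≠ 0 := by
  have hS : (ℝ ∙ x)ᗮ ≠ ⊤ := by
    intro h
    rw [Submodule.orthogonal_eq_top_iff, Submodule.span_singleton_eq_bot] at h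
    exact hx h
  refine measure_mono_null (fun g hg => ?_) (stdGaussian_submodule _ hS)
  simp only [Set.mem_compl_iff, Set.mem_ofPred_eq, not_not] at hg
  exact Submodule.mem_orthogonal_singleton_iff_inner_left.2 hg

/-- The first coordinate alone separates the points: almost surely it is not orthogonal to any of
the finitely many nonzero differences. -/
theorem ae_injOn_proj (W : Finset (EuclideanSpace ℝ (Fin n))) :
    ∀ᵐ p ∂uniformFrame n, Set.InjOn (proj p) W := by
  have h1 : ∀ᵐ p ∂uniformFrame n, ∀ v ∈ W, ∀ w ∈ W, v ≠ w → ⟪p.1, v - w⟫ ≠ 0 := by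
    refine (Finset.eventually_all W).2 fun v _ => (Finset.eventually_all W).2 fun w _ => ?_
    by_cases hvw : v = w
    · simp [hvw]
    have hm : MeasurableSet {p : EuclideanSpace ℝ (Fin n) × EuclideanSpace ℝ (Fin n) |
        v ≠ w → ⟪p.1, v - w⟫ ≠ 0} := by
      simp only [ne_eq, hvw, not_false_eq_true, true_imp_iff]
      exact (measurableSet_eq_fun (by fun_prop) (by fun_prop)).compl
    refine (ae_map_iff (measurable_gramSchmidtPair n).aemeasurable hm).2 ?_
    have h2 := (Measure.quasiMeasurePreserving_fst (μ := stdGaussian (EuclideanSpace ℝ (Fin n)))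
      (ν := stdGaussian (EuclideanSpace ℝ (Fin n)))).ae
      (ae_stdGaussian_inner_ne_zero (sub_ne_zero.2 hvw))
    filter_upwards [h2] with g hg _
    have hg0 : g.1 ≠ 0 := by
      intro h
      exact hg (by rw [h, inner_zero_left])
    simp only [gramSchmidtPair, real_inner_smul_left]
    exact mul_ne_zero (inv_ne_zero (norm_ne_zero_iff.2 hg0)) hg
  filter_upwards [h1] with p hp v hv w hw hvw
  by_contra hne
  refine hp v hv w hw hne ?_
  rw [inner_sub_right, sub_eq_zero]
  exact congrArg Prod.fst hvw

theorem aemeasurable_numShadowVertices (W : Finset (EuclideanSpace ℝ (Fin n))) :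
    AEMeasurable (numShadowVertices (convexHull ℝ (W : Set (EuclideanSpace ℝ (Fin n)))))
      (uniformFrame n) :=
  ⟨hitCount W, measurable_hitCount W,
    (ae_injOn_proj W).mono fun p hp => numShadowVertices_eq_hitCount W p hp⟩

theorem expectedShadowVertices_le {W : Finset (EuclideanSpace ℝ (Fin n))} {K τ : ℝ}
    (hW : IsWide W K τ) (hτ : 0 < τ) (hK : 0 ≤ K) (hnt : W.Nontrivial) :
    expectedShadowVertices (convexHull ℝ (W : Set (EuclideanSpace ℝ (Fin n))))
      ≤ ENNReal.ofReal (12 * Real.pi * (K / τ) * n) := by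
  rw [expectedShadowVertices, lintegral_congr_ae
    ((ae_injOn_proj W).mono fun p hp => numShadowVertices_eq_hitCount W p hp), uniformFrame,
    lintegral_map (measurable_hitCount W) (measurable_gramSchmidtPair n)]
  exact (lintegral_mono (hitCount_gramSchmidtPair_le W)).trans
    (lintegral_hitCount_le hW hτ hK hnt)

/-! ### Polyhedra: vertices, active rows and the width of normal cones. -/

variable {m : ℕ}

/-- A row of an integral matrix as a real vector. -/
noncomputable def rowVec (A : Matrix (Fin m) (Fin n) ℤ) (i : Fin m) : EuclideanSpace ℝ (Fin n) :=
  WithLp.toLp 2 fun j => (A i j : ℝ)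

theorem mem_polyhedron_iff {A : Matrix (Fin m) (Fin n) ℤ} {b : Fin m → ℝ}
    {x : EuclideanSpace ℝ (Fin n)} : x ∈ polyhedron A b ↔ ∀ i, ⟪rowVec A i, x⟫ ≤ b i := by
  simp [polyhedron, rowVec, PiLp.inner_apply, mul_comm]

theorem polyhedron_eq_iInter (A : Matrix (Fin m) (Fin n) ℤ) (b : Fin m → ℝ) :
    polyhedron A b = ⋂ i, {x | ⟪rowVec A i, x⟫ ≤ b i} := by
  ext x
  simp [mem_polyhedron_iff]

theorem convex_polyhedron (A : Matrix (Fin m) (Fin n) ℤ) (b : Fin m → ℝ) :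
    Convex ℝ (polyhedron A b) := by
  rw [polyhedron_eq_iInter]
  exact convex_iInter fun i => convex_halfSpace_le (innerSL ℝ (rowVec A i)).isLinear (b i)

theorem isClosed_polyhedron (A : Matrix (Fin m) (Fin n) ℤ) (b : Fin m → ℝ) :
    IsClosed (polyhedron A b) := by
  rw [polyhedron_eq_iInter]
  exact isClosed_iInter fun i => isClosed_le (by fun_prop) continuous_const

/-- Inactive constraints have slack, so `v ± ε • x` stays in the polyhedron for small `ε`;
extremality then forces `x = 0`. -/
theorem eq_zero_of_inner_active_eq_zero {A : Matrix (Fin m) (Fin n) ℤ} {b : Fin m → ℝ}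
    {v : EuclideanSpace ℝ (Fin n)} (hv : v ∈ (polyhedron A b).extremePoints ℝ)
    {x : EuclideanSpace ℝ (Fin n)}
    (hx : ∀ i, ⟪rowVec A i, v⟫ = b i → ⟪rowVec A i, x⟫ = 0) : x = 0 := by
  have hvP := mem_polyhedron_iff.1 hv.1
  have hev : ∀ᶠ ε : ℝ in nhds 0, v + ε • x ∈ polyhedron A b := by
    simp_rw [mem_polyhedron_iff]
    refine Filter.eventually_all.2 fun i => ?_
    by_cases hi : ⟪rowVec A i, v⟫ = b i
    · refine Filter.Eventually.of_forall fun ε => ?_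
      rw [inner_add_right, real_inner_smul_right, hx i hi, hi, mul_zero, add_zero]
    · have hlt := lt_of_le_of_ne (hvP i) hi
      have hc : Continuous fun ε : ℝ => ⟪rowVec A i, v + ε • x⟫ := by fun_prop
      have ht := hc.tendsto 0
      simp only [zero_smul, add_zero] at ht
      exact ht.eventually_le_const hlt
  obtain ⟨δ, hδ, hball⟩ := Metric.eventually_nhds_iff.1 hev
  have hp : v + (δ / 2) • x ∈ polyhedron A b := hball (by
    rw [Real.dist_eq, sub_zero, abs_of_pos (by positivity)]; linarith)
  have hm : v + (-(δ / 2)) • x ∈ polyhedron A b := hball (by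
    rw [Real.dist_eq, sub_zero, abs_neg, abs_of_pos (by positivity)]; linarith)
  have h := (mem_extremePoints_iff_left.1 hv).2 _ hp _ hm
    ⟨1 / 2, 1 / 2, by norm_num, by norm_num, by norm_num, by module⟩
  have h' : (δ / 2) • x = 0 := by simpa using h
  exact (smul_eq_zero.1 h').resolve_left (by positivity)

theorem finite_extremePoints_polyhedron (A : Matrix (Fin m) (Fin n) ℤ) (b : Fin m → ℝ) :
    ((polyhedron A b).extremePoints ℝ).Finite := by
  refine Set.Finite.of_injOn (f := fun v => {i | ⟪rowVec A i, v⟫ = b i}) (t := Set.univ)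
    (fun _ _ => Set.mem_univ _) ?_ Set.finite_univ
  intro v hv w hw hvw
  rw [← sub_eq_zero]
  refine eq_zero_of_inner_active_eq_zero hv fun i hi => ?_
  have hi' : i ∈ {i | ⟪rowVec A i, w⟫ = b i} := by
    rw [← show _ = {i | ⟪rowVec A i, w⟫ = b i} from hvw]
    exact hi
  rw [inner_sub_right, hi, show ⟪rowVec A i, w⟫ = b i from hi', sub_self]

theorem exists_linearIndependent_active {A : Matrix (Fin m) (Fin n) ℤ} {b : Fin m → ℝ}
    {v : EuclideanSpace ℝ (Fin n)} (hv : v ∈ (polyhedron A b).extremePoints ℝ) :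
    ∃ f : Fin n → Fin m, (∀ k, ⟪rowVec A (f k), v⟫ = b (f k)) ∧
      LinearIndependent ℝ fun k => rowVec A (f k) := by
  set s := rowVec A '' {i | ⟪rowVec A i, v⟫ = b i} with hs
  have htop : Submodule.span ℝ s = ⊤ := by
    rw [← Submodule.orthogonal_eq_bot_iff, Submodule.eq_bot_iff]
    intro x hx
    refine eq_zero_of_inner_active_eq_zero hv fun i hi => ?_
    exact (Submodule.mem_orthogonal _ _).1 hx _ (Submodule.subset_span ⟨i, hi, rfl⟩)
  obtain ⟨g, hg, -, hlin⟩ := Submodule.exists_fun_fin_finrank_span_eq ℝ s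
  have hrank : Module.finrank ℝ (Submodule.span ℝ s) = n := by
    rw [htop, finrank_top, finrank_euclideanSpace_fin]
  choose f hf hfg using fun k => hg (Fin.cast hrank.symm k)
  refine ⟨f, hf, ?_⟩
  have : (fun k => rowVec A (f k)) = g ∘ Fin.cast hrank.symm := funext hfg
  rw [this]
  exact hlin.comp _ (Fin.cast_injective _)

/-- Cramer's rule: each entry is, up to sign, a minor of order `n - 1` divided by a nonzero integer.
For `n ≥ 2` this minor has order at least one, so `hA` applies to it. -/
theorem abs_inv_submatrix_le {A : Matrix (Fin m) (Fin n) ℤ} {Δ : ℝ} (hn : 2 ≤ n)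
    (hA : SubdetsBoundedBy A Δ) {f : Fin n → Fin m} (hf : f.Injective)
    (hdet : (A.submatrix f id).det ≠ 0) (i j : Fin n) :
    |((A.submatrix f id).map (Int.cast : ℤ → ℝ))⁻¹ i j| ≤ Δ := by
  obtain ⟨k, rfl⟩ : ∃ k, n = k + 1 := ⟨n - 1, by omega⟩
  set M := A.submatrix f id with hM
  have hadj : |(M.map (Int.cast : ℤ → ℝ)).adjugate i j| ≤ Δ := by
    rw [Matrix.adjugate_fin_succ_eq_det_submatrix, abs_mul, abs_pow, abs_neg, abs_one, one_pow,
      one_mul]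
    have h := hA k (by omega) (f ∘ j.succAbove) i.succAbove
      (hf.comp Fin.succAbove_right_injective) Fin.succAbove_right_injective
    rwa [Int.cast_det] at h
  have hdet1 : (1 : ℝ) ≤ |(M.map (Int.cast : ℤ → ℝ)).det| := by
    rw [← Int.cast_det, ← Int.cast_abs]
    exact_mod_cast Int.one_le_abs hdet
  rw [Matrix.inv_def, Matrix.smul_apply, Ring.inverse_eq_inv', smul_eq_mul, abs_mul, abs_inv]
  calc _ ≤ 1 * |(M.map (Int.cast : ℤ → ℝ)).adjugate i j| := by
        gcongr
        exact inv_le_one_of_one_le₀ hdet1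
    _ ≤ Δ := by rwa [one_mul]

theorem abs_entry_le {A : Matrix (Fin m) (Fin n) ℤ} {Δ : ℝ} (hA : SubdetsBoundedBy A Δ)
    (i : Fin m) (j : Fin n) : |(A i j : ℝ)| ≤ Δ := by
  simpa using hA 1 le_rfl (fun _ => i) (fun _ => j) (Function.injective_of_subsingleton _)
    (Function.injective_of_subsingleton _)

theorem norm_le_sqrt_mul {Δ : ℝ} (hΔ : 0 ≤ Δ) {x : EuclideanSpace ℝ (Fin n)}
    (hx : ∀ j, |x j| ≤ Δ) : ‖x‖ ≤ √n * Δ := by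
  refine abs_le_of_sq_le_sq' ?_ (by positivity) |>.2
  rw [EuclideanSpace.real_norm_sq_eq, mul_pow, Real.sq_sqrt (by positivity)]
  calc ∑ j, x j ^ 2 ≤ ∑ _j : Fin n, Δ ^ 2 :=
        Finset.sum_le_sum fun j _ => sq_le_sq.2 ((hx j).trans (le_abs_self Δ))
    _ = n * Δ ^ 2 := by simp

theorem sum_abs_le_sqrt_mul_norm (x : EuclideanSpace ℝ (Fin n)) : ∑ j, |x j| ≤ √n * ‖x‖ := by
  refine abs_le_of_sq_le_sq' ?_ (by positivity) |>.2
  rw [mul_pow, Real.sq_sqrt (by positivity), EuclideanSpace.real_norm_sq_eq]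
  simpa using sq_sum_le_card_mul_sum_sq (s := Finset.univ) (f := fun j => |x j|)

/-- The normal cone of every vertex is wide if all subdeterminants are small. -/
theorem exists_ball_subset_normalCone {A : Matrix (Fin m) (Fin n) ℤ} {b : Fin m → ℝ} {Δ : ℝ}
    (hn : 2 ≤ n) (hA : SubdetsBoundedBy A Δ) {v : EuclideanSpace ℝ (Fin n)}
    (hv : v ∈ (polyhedron A b).extremePoints ℝ) :
    1 ≤ Δ ∧ ∃ c : EuclideanSpace ℝ (Fin n), ‖c‖ ≤ n * (√n * Δ) ∧
      ∀ y, ‖y‖ ≤ (√n * Δ)⁻¹ → ∀ w ∈ polyhedron A b, ⟪c + y, w⟫ ≤ ⟪c + y, v⟫ := by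
  obtain ⟨f, hact, hlin⟩ := exists_linearIndependent_active hv
  have hf : f.Injective := fun i j hij => hlin.injective (by simp only [hij])
  set M := (A.submatrix f id).map (Int.cast : ℤ → ℝ) with hM
  have hunit : IsUnit M := by
    rw [← Matrix.linearIndependent_rows_iff_isUnit]
    exact hlin.map' (WithLp.linearEquiv 2 ℝ (Fin n → ℝ)).toLinearMap (LinearEquiv.ker _)
  have hdetM : M.det ≠ 0 := ((Matrix.isUnit_iff_isUnit_det M).1 hunit).ne_zero
  have hdet : (A.submatrix f id).det ≠ 0 := by
    rw [hM, ← Int.cast_det] at hdetM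
    exact_mod_cast hdetM
  have hΔ : 1 ≤ Δ := by
    refine le_trans ?_ (hA n (by omega) f id hf Function.injective_id)
    rw [← Int.cast_abs]
    exact_mod_cast Int.one_le_abs hdet
  have hΔ0 : 0 < Δ := by linarith
  have hn0 : (0 : ℝ) < √n := Real.sqrt_pos.2 (by exact_mod_cast (by omega : 0 < n))
  -- The centre is the sum of `n` independent active rows. A perturbation `y` has coordinates `μ k`
  -- in these rows with `|μ k| ≤ 1`, so all coefficients `1 + μ k` stay nonnegative.
  refine ⟨hΔ, ∑ k, rowVec A (f k), ?_, fun y hy w hw => ?_⟩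
  · calc ‖∑ k, rowVec A (f k)‖ ≤ ∑ k, ‖rowVec A (f k)‖ := norm_sum_le _ _
      _ ≤ ∑ _k : Fin n, √n * Δ := Finset.sum_le_sum fun k _ =>
          norm_le_sqrt_mul hΔ0.le fun j => abs_entry_le hA (f k) j
      _ = n * (√n * Δ) := by simp
  · set μ : Fin n → ℝ := Matrix.vecMul y.ofLp M⁻¹ with hμ
    have hμle : ∀ k, |μ k| ≤ 1 := by
      intro k
      calc |μ k| ≤ ∑ j, |y j * M⁻¹ j k| :=
            Finset.abs_sum_le_sum_abs (fun j => y j * M⁻¹ j k) Finset.univ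
        _ ≤ ∑ j, |y j| * Δ := by
            refine Finset.sum_le_sum fun j _ => ?_
            rw [abs_mul]
            exact mul_le_mul_of_nonneg_left (abs_inv_submatrix_le hn hA hf hdet j k) (abs_nonneg _)
        _ = (∑ j, |y j|) * Δ := by rw [Finset.sum_mul]
        _ ≤ √n * (√n * Δ)⁻¹ * Δ := by
            gcongr
            exact (sum_abs_le_sqrt_mul_norm y).trans (by gcongr)
        _ = 1 := by field_simp
    have hy' : y = ∑ k, μ k • rowVec A (f k) := by
      have h : Matrix.vecMul μ M = y.ofLp := by
        rw [hμ, Matrix.vecMul_vecMul, Matrix.nonsing_inv_mul _ hdetM.isUnit, Matrix.vecMul_one]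
      ext j
      rw [← congrFun h j]
      simp [Matrix.vecMul, dotProduct, rowVec, hM]
    have hsum : ∑ k, rowVec A (f k) + y = ∑ k, (1 + μ k) • rowVec A (f k) := by
      rw [hy', ← Finset.sum_add_distrib]
      simp_rw [add_smul, one_smul]
    rw [hsum, sum_inner, sum_inner]
    refine Finset.sum_le_sum fun k _ => ?_
    rw [real_inner_smul_left, real_inner_smul_left, hact k]
    exact mul_le_mul_of_nonneg_left (mem_polyhedron_iff.1 hw (f k))
      (by linarith [(abs_le.1 (hμle k)).1])

theorem exists_finset_convexHull_eq_polyhedron {A : Matrix (Fin m) (Fin n) ℤ} {b : Fin m → ℝ}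
    (hn : 2 ≤ n) (hbdd : Bornology.IsBounded (polyhedron A b))
    (hint : (interior (polyhedron A b)).Nonempty) :
    ∃ W : Finset (EuclideanSpace ℝ (Fin n)), W.Nontrivial ∧
      (W : Set (EuclideanSpace ℝ (Fin n))) = (polyhedron A b).extremePoints ℝ ∧
      convexHull ℝ (W : Set (EuclideanSpace ℝ (Fin n))) = polyhedron A b := by
  have hfin := finite_extremePoints_polyhedron A b
  have hcomp : IsCompact (polyhedron A b) :=
    Metric.isCompact_of_isClosed_isBounded (isClosed_polyhedron A b) hbdd
  have hhull : convexHull ℝ ((polyhedron A b).extremePoints ℝ) = polyhedron A b := by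
    rw [← (hfin.isClosed_convexHull ℝ).closure_eq,
      closure_convexHull_extremePoints hcomp (convex_polyhedron A b)]
  refine ⟨hfin.toFinset, ?_, hfin.coe_toFinset, by rw [hfin.coe_toFinset, hhull]⟩
  have : Nonempty (Fin n) := ⟨⟨0, by omega⟩⟩
  -- With at most one vertex the polytope would be empty or a point, contradicting `hint`.
  rw [← Finset.nontrivial_coe, hfin.coe_toFinset, ← Set.not_subsingleton_iff]
  intro hsub
  rcases hsub.eq_empty_or_singleton with h | ⟨v, h⟩
  · rw [h, convexHull_empty] at hhull
    simp [← hhull] at hint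
  · rw [h, convexHull_singleton] at hhull
    have : Nontrivial (EuclideanSpace ℝ (Fin n)) :=
      Module.nontrivial_of_finrank_pos (R := ℝ) (by rw [finrank_euclideanSpace_fin]; omega)
    have : (nhdsWithin v {v}ᶜ).NeBot := Module.punctured_nhds_neBot ℝ _ v
    rw [← hhull, interior_singleton] at hint
    exact Set.not_nonempty_empty hint

/-! ### The bounds in terms of `Δ`. -/

theorem subdetsBoundedBy_one_of_isTotallyUnimodular {A : Matrix (Fin m) (Fin n) ℤ}
    (hA : A.IsTotallyUnimodular) : SubdetsBoundedBy A 1 := by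
  intro k _ f g hf hg
  obtain ⟨s, hs⟩ := hA k f g hf hg
  rw [← hs]
  cases s <;> simp

theorem expectedShadowVertices_polyhedron_le {A : Matrix (Fin m) (Fin n) ℤ} {b : Fin m → ℝ}
    {Δ : ℝ} (hn : 2 ≤ n) (hbdd : Bornology.IsBounded (polyhedron A b))
    (hint : (interior (polyhedron A b)).Nonempty) (hA : SubdetsBoundedBy A Δ) :
    expectedShadowVertices (polyhedron A b)
      ≤ ENNReal.ofReal (12 * Real.pi * (n : ℝ) ^ 3 * Δ ^ 2) := by
  obtain ⟨W, hnt, hW, hhull⟩ := exists_finset_convexHull_eq_polyhedron hn hbdd hint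
  have hWP : ∀ v ∈ W, v ∈ (polyhedron A b).extremePoints ℝ := fun v hv => hW ▸ hv
  obtain ⟨v₀, hv₀⟩ := hnt.nonempty
  -- `Δ` is an arbitrary real; a vertex supplies a nonzero integer subdeterminant, hence `1 ≤ Δ`.
  have hΔ : 1 ≤ Δ := (exists_ball_subset_normalCone hn hA (hWP v₀ hv₀)).1
  have hn0 : (0 : ℝ) < √n := Real.sqrt_pos.2 (by exact_mod_cast (by omega : 0 < n))
  have hwide : IsWide W (n * (√n * Δ)) (√n * Δ)⁻¹ := by
    intro v hv
    obtain ⟨-, c, hc, hball⟩ := exists_ball_subset_normalCone hn hA (hWP v hv)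
    exact ⟨c, hc, fun y hy w hw => hball y hy w (hWP w hw).1⟩
  have h := expectedShadowVertices_le hwide (by positivity) (by positivity) hnt
  rw [hhull] at h
  refine h.trans (le_of_eq ?_)
  congr 1
  have hsq : √(n : ℝ) ^ 2 = n := Real.sq_sqrt (by positivity)
  rw [div_inv_eq_mul]
  linear_combination 12 * Real.pi * (n : ℝ) ^ 2 * Δ ^ 2 * hsq

end RandomShadow

theorem mainTheorem4 :
    ∃ C : ℝ, ∀ (m n : ℕ), 2 ≤ n → ∀ (A : Matrix (Fin m) (Fin n) ℤ) (b : Fin m → ℝ),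
      Bornology.IsBounded (RandomShadow.polyhedron A b) →
      (interior (RandomShadow.polyhedron A b)).Nonempty →
        AEMeasurable (RandomShadow.numShadowVertices (RandomShadow.polyhedron A b))
          (RandomShadow.uniformFrame n) ∧
        (∀ Δ : ℝ, RandomShadow.SubdetsBoundedBy A Δ →
          RandomShadow.expectedShadowVertices (RandomShadow.polyhedron A b)
            ≤ ENNReal.ofReal (C * (n : ℝ) ^ 3 * Δ ^ 2)) ∧
        (A.IsTotallyUnimodular →
          RandomShadow.expectedShadowVertices (RandomShadow.polyhedron A b)
            ≤ ENNReal.ofReal (C * (n : ℝ) ^ 3)) := by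
  refine ⟨12 * Real.pi, fun m n hn A b hbdd hint => ⟨?_, fun Δ hA => ?_, fun hA => ?_⟩⟩
  · obtain ⟨W, -, -, hhull⟩ :=
      RandomShadow.exists_finset_convexHull_eq_polyhedron hn hbdd hint
    rw [← hhull]
    exact RandomShadow.aemeasurable_numShadowVertices W
  · exact RandomShadow.expectedShadowVertices_polyhedron_le hn hbdd hint hA
  · simpa using RandomShadow.expectedShadowVertices_polyhedron_le hn hbdd hint
      (RandomShadow.subdetsBoundedBy_one_of_isTotallyUnimodular hA)
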